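/- Let $F$ be a field of characteristic different from $2$, and let $W(F)$ be its Witt ring, i.e. the ring of Witt classes of nonsingular finite-dimensional quadratic forms over $F$, with addition induced by orthogonal sum and multiplication by tensor product. Let $I(F)\subset W(F)$ be the fundamental ideal of classes of even-dimensional forms, and let $$A(F)=\{f(X)\in\mathbb Z[X] : f(\varphi)=0\ \text{ for all }\ \varphi\in W(F)\}$$ be the full annihilator ideal. Suppose that $F$ is nonreal (that is, $-1$ is a sum of squares in $F$), and that its level $s(F)$, the least $n$ such that $-1$ is a sum of $n$ squares in $F$, equals $2^{r-1}$ with $r\ge 1$. Let $\nu_2$ denote the $2$-adic valuation and let $k\ge 1$ be the integer uniquely determined by $$\nu_2((2k-2)!)<r\le \nu_2((2k)!).$$ If $s(F)\cdot I(F)^{2k-1}\neq 0$ in $W(F)$, then $$A(F)=J_r=J_{e,r}\cdot J_{o,r},$$ where $J_r$, $J_{e,r}$ and $J_{o,r}$ are the following ideals of $\mathbb Z[X]$: - $J_r$ is generated by $2^{r-\nu_2((2i)!)}X^{2i}(X-1)^{2i}$ for $0\le i\le k-1$ together with $X^{2k}(X-1)^{2k}$; - $J_{e,r}$ is generated by $2^{r-\nu_2((2i)!)}X^{2i}$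 for $0\le i\le k-1$ together with $X^{2k}$; - $J_{o,r}$ is generated by $2^{r-\nu_2((2i)!)}(X-1)^{2i}$ for $0\le i\le k-1$ together with $(X-1)^{2k}$. -/

import Mathlib

open scoped TensorProduct

universe u

namespace QuadWitt

noncomputable section

/-! ### Nonsingular quadratic spaces and their isometry classes -/

/-- A nonsingular quadratic form over `F` on a finite-dimensional vector space. -/
structure QuadSpace (F : Type u) [Field F] where
  V : Type u
  [addCommGroup : AddCommGroup V]
  [module : Module F V]
  [finite : FiniteDimensional F V]
  form : QuadraticForm F V
  nondegenerate : form.Nondegenerate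

attribute [instance] QuadSpace.addCommGroup QuadSpace.module QuadSpace.finite

section Nondegeneracy

variable {F : Type u} [Field F] [Invertible (2 : F)]
variable {V W : Type u} [AddCommGroup V] [Module F V] [AddCommGroup W] [Module F W]

theorem nondegenerate_iff {Q : QuadraticForm F V} :
    Q.Nondegenerate ↔ Function.Injective (QuadraticMap.associated Q) := by
  rw [QuadraticMap.nondegenerate_iff_radical_eq_bot, QuadraticMap.radical_eq_ker_associated,
    LinearMap.ker_eq_bot]

theorem nondegenerate_prod {Q : QuadraticForm F V} {Q' : QuadraticForm F W}
    (h : Q.Nondegenerate) (h' : Q'.Nondegenerate) :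
    QuadraticMap.Nondegenerate (Q := Q.prod Q') := by
  rw [nondegenerate_iff, injective_iff_map_eq_zero] at *
  rintro ⟨x, y⟩ hxy
  have hx : x = 0 := h x <| by
    ext v
    simpa using congr($hxy (v, 0))
  have hy : y = 0 := h' y <| by
    ext v
    simpa using congr($hxy (0, v))
  rw [hx, hy, Prod.mk_zero_zero]

theorem nondegenerate_neg {Q : QuadraticForm F V} (h : Q.Nondegenerate) :
    QuadraticMap.Nondegenerate (Q := -Q) := by
  rw [nondegenerate_iff, injective_iff_map_eq_zero] at *
  intro x hx
  refine h x ?_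
  simpa using hx

theorem nondegenerate_tmul [FiniteDimensional F V] [FiniteDimensional F W]
    {Q : QuadraticForm F V} {Q' : QuadraticForm F W}
    (h : Q.Nondegenerate) (h' : Q'.Nondegenerate) :
    QuadraticMap.Nondegenerate (Q := QuadraticForm.tmul Q Q') := by
  rw [nondegenerate_iff] at *
  let e := LinearEquiv.ofInjectiveOfFinrankEq (QuadraticMap.associated Q) h
    (Subspace.dual_finrank_eq (K := F) (V := V)).symm
  let e' := LinearEquiv.ofInjectiveOfFinrankEq (QuadraticMap.associated Q') h'
    (Subspace.dual_finrank_eq (K := F) (V := W)).symm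
  let f := (TensorProduct.congr e e').trans (TensorProduct.dualDistribEquiv F V W)
  have hf : (QuadraticMap.associated (QuadraticForm.tmul Q Q') :
      V ⊗[F] W →ₗ[F] V ⊗[F] W →ₗ[F] F) = f.toLinearMap := by
    rw [QuadraticForm.associated_tmul]
    ext v w v' w'
    simp [f, e, e', TensorProduct.dualDistribEquiv, mul_comm]
    rfl
  rw [hf]
  exact f.injective

theorem nondegenerate_sq :
    QuadraticMap.Nondegenerate (Q := (QuadraticMap.sq : QuadraticForm F F)) := by
  rw [nondegenerate_iff, injective_iff_map_eq_zero]
  intro x hx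
  simpa using congr($hx 1)

theorem nondegenerate_dualProd [FiniteDimensional F V] :
    QuadraticMap.Nondegenerate (Q := QuadraticForm.dualProd F V) := by
  rw [nondegenerate_iff, injective_iff_map_eq_zero]
  rintro ⟨f, v⟩ h
  have hf : f = 0 := by
    ext w
    have := congr($h (0, w))
    simpa [QuadraticMap.associated_apply, QuadraticMap.polar, Invertible.ne_zero (2 : F)] using this
  have hv : v = 0 := by
    rw [← Module.forall_dual_apply_eq_zero_iff F]
    intro g
    have := congr($h (g, 0))
    simpa [QuadraticMap.associated_apply, QuadraticMap.polar, Invertible.ne_zero (2 : F)] using this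
  rw [hf, hv, Prod.mk_zero_zero]

theorem nondegenerate_punit :
    QuadraticMap.Nondegenerate (Q := (0 : QuadraticForm F PUnit.{u + 1})) := by
  rw [nondegenerate_iff]
  exact Function.injective_of_subsingleton _

end Nondegeneracy

/-! ### Isometries -/

section Isometries

variable {F : Type u} [Field F]
variable {V₁ V₂ V₃ V₄ : Type u} [AddCommGroup V₁] [Module F V₁] [AddCommGroup V₂] [Module F V₂]
  [AddCommGroup V₃] [Module F V₃] [AddCommGroup V₄] [Module F V₄]

def prodAssoc (Q₁ : QuadraticForm F V₁) (Q₂ : QuadraticForm F V₂) (Q₃ : QuadraticForm F V₃) :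
    ((Q₁.prod Q₂).prod Q₃).IsometryEquiv (Q₁.prod (Q₂.prod Q₃)) where
  toLinearEquiv := LinearEquiv.prodAssoc F V₁ V₂ V₃
  map_app' x := by simp [add_assoc]

def zeroProd (Q : QuadraticForm F V₁) :
    ((0 : QuadraticForm F PUnit.{u + 1}).prod Q).IsometryEquiv Q where
  toLinearEquiv := LinearEquiv.uniqueProd
  map_app' x := by simp

def dualProdPUnit :
    (QuadraticForm.dualProd F PUnit.{u + 1}).IsometryEquiv
      (0 : QuadraticForm F PUnit.{u + 1}) where
  toLinearEquiv := LinearEquiv.ofSubsingleton _ _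
  map_app' x := by
    have : x.2 = 0 := rfl
    rw [QuadraticForm.dualProd_apply, this]
    exact (map_zero x.1).symm

variable [Invertible (2 : F)]

def tmulCongr {Q₁ : QuadraticForm F V₁} {Q₂ : QuadraticForm F V₂} {Q₃ : QuadraticForm F V₃}
    {Q₄ : QuadraticForm F V₄} (e : Q₁.IsometryEquiv Q₂) (f : Q₃.IsometryEquiv Q₄) :
    (QuadraticForm.tmul Q₁ Q₃).IsometryEquiv (QuadraticForm.tmul Q₂ Q₄) where
  toLinearEquiv := TensorProduct.congr e.toLinearEquiv f.toLinearEquiv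
  map_app' x := QuadraticForm.tmul_tensorMap_apply e.toIsometry f.toIsometry x

def tmulProd (Q₁ : QuadraticForm F V₁) (Q₂ : QuadraticForm F V₂) (Q₃ : QuadraticForm F V₃) :
    (QuadraticForm.tmul Q₁ (Q₂.prod Q₃)).IsometryEquiv
      ((QuadraticForm.tmul Q₁ Q₂).prod (QuadraticForm.tmul Q₁ Q₃)) where
  toLinearEquiv := TensorProduct.prodRight F F V₁ V₂ V₃
  map_app' x := by
    have : (((QuadraticForm.tmul Q₁ Q₂).prod (QuadraticForm.tmul Q₁ Q₃)).comp
        (TensorProduct.prodRight F F V₁ V₂ V₃).toLinearMap) =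
        QuadraticForm.tmul Q₁ (Q₂.prod Q₃) := by
      refine (QuadraticMap.associated_rightInverse F).injective ?_
      ext <;> simp [QuadraticForm.associated_tmul, QuadraticMap.associated_comp]
    exact congr($this x)

def zeroTmul (Q : QuadraticForm F V₁) :
    (QuadraticForm.tmul (0 : QuadraticForm F PUnit.{u + 1}) Q).IsometryEquiv
      (0 : QuadraticForm F PUnit.{u + 1}) where
  toLinearEquiv := LinearEquiv.ofSubsingleton _ _
  map_app' x := by
    rw [Subsingleton.elim x 0, QuadraticMap.map_zero]
    rfl

def tmulNegSq (Q : QuadraticForm F V₁) :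
    (QuadraticForm.tmul Q (-(QuadraticMap.sq : QuadraticForm F F))).IsometryEquiv (-Q) where
  toLinearEquiv := TensorProduct.rid F V₁
  map_app' x := by
    have : QuadraticForm.tmul Q (-(QuadraticMap.sq : QuadraticForm F F)) =
        -(QuadraticForm.tmul Q (QuadraticMap.sq : QuadraticForm F F)) := by
      rw [QuadraticForm.tmul, TensorProduct.tmul_neg]
      exact map_neg (QuadraticForm.tensorDistrib F F) _
    rw [this]
    exact congrArg Neg.neg (QuadraticForm.tmul_tensorRId_apply Q x)

def prodNeg [FiniteDimensional F V₁] (Q : QuadraticForm F V₁) (hQ : Q.Nondegenerate) :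
    (Q.prod (-Q)).IsometryEquiv (QuadraticForm.dualProd F V₁) where
  toLinearEquiv := LinearEquiv.ofInjectiveOfFinrankEq (QuadraticForm.toDualProd Q).toLinearMap
    (by
      rw [nondegenerate_iff, injective_iff_map_eq_zero] at hQ
      rw [injective_iff_map_eq_zero]
      rintro ⟨x, y⟩ hxy
      have h₂ : x = y := sub_eq_zero.mp congr(($hxy).2)
      have h₁ : QuadraticMap.associated Q x + QuadraticMap.associated Q y = 0 := congr(($hxy).1)
      subst h₂
      have hx : x = 0 := hQ x <| by
        rw [← two_smul F] at h₁
        exact (smul_eq_zero.mp h₁).resolve_left (Invertible.ne_zero (2 : F))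
      rw [hx, Prod.mk_zero_zero])
    (by rw [Module.finrank_prod, Module.finrank_prod, Subspace.dual_finrank_eq])
  map_app' x := (QuadraticForm.toDualProd Q).map_app x

end Isometries

/-! ### The semiring of isometry classes -/

section IsoClass

variable (F : Type u) [Field F]

instance isometrySetoid : Setoid (QuadSpace F) where
  r X Y := X.form.Equivalent Y.form
  iseqv := ⟨fun _ => .refl _, fun h => h.symm, fun h h' => h.trans h'⟩

/-- Isometry classes of nonsingular quadratic forms over `F`. -/
def IsoClass : Type (u + 1) := Quotient (isometrySetoid F)

variable {F}

/-- The isometry class of a nonsingular quadratic form. -/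
def IsoClass.mk (X : QuadSpace F) : IsoClass F := Quotient.mk _ X

theorem IsoClass.sound {X Y : QuadSpace F} (e : X.form.IsometryEquiv Y.form) :
    IsoClass.mk X = IsoClass.mk Y := Quotient.sound ⟨e⟩

variable [Invertible (2 : F)]

/-- The orthogonal sum. -/
def QuadSpace.add (X Y : QuadSpace F) : QuadSpace F :=
  ⟨X.V × Y.V, X.form.prod Y.form, nondegenerate_prod X.nondegenerate Y.nondegenerate⟩

/-- The tensor product. -/
def QuadSpace.mul (X Y : QuadSpace F) : QuadSpace F :=
  ⟨X.V ⊗[F] Y.V, QuadraticForm.tmul X.form Y.form,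
    nondegenerate_tmul X.nondegenerate Y.nondegenerate⟩

/-- The form `-q`. -/
def QuadSpace.neg (X : QuadSpace F) : QuadSpace F :=
  ⟨X.V, -X.form, nondegenerate_neg X.nondegenerate⟩

variable (F) in
/-- The zero-dimensional form. -/
def QuadSpace.zero : QuadSpace F := ⟨PUnit, 0, nondegenerate_punit⟩

variable (F) in
/-- The form `⟨1⟩`. -/
def QuadSpace.one : QuadSpace F := ⟨F, QuadraticMap.sq, nondegenerate_sq⟩

variable (F) in
/-- The hyperbolic space `V* × V` with `(f, v) ↦ f v`. -/
def QuadSpace.hyperbolic (V : Type u) [AddCommGroup V] [Module F V] [FiniteDimensional F V] :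
    QuadSpace F :=
  ⟨Module.Dual F V × V, QuadraticForm.dualProd F V, nondegenerate_dualProd⟩

instance : Zero (IsoClass F) := ⟨.mk (.zero F)⟩

instance : One (IsoClass F) := ⟨.mk (.one F)⟩

instance : Add (IsoClass F) :=
  ⟨Quotient.map₂ QuadSpace.add fun _ _ ⟨e⟩ _ _ ⟨f⟩ => ⟨QuadraticMap.IsometryEquiv.prod e f⟩⟩

instance : Mul (IsoClass F) :=
  ⟨Quotient.map₂ QuadSpace.mul fun _ _ ⟨e⟩ _ _ ⟨f⟩ => ⟨tmulCongr e f⟩⟩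

theorem IsoClass.mk_add (X Y : QuadSpace F) : mk (X.add Y) = mk X + mk Y := rfl

theorem IsoClass.mk_mul (X Y : QuadSpace F) : mk (X.mul Y) = mk X * mk Y := rfl

namespace IsoClass

protected theorem add_comm' (x y : IsoClass F) : x + y = y + x := by
  induction x, y using Quotient.inductionOn₂ with
  | h X Y => exact sound (X := X.add Y) (Y := Y.add X) (.prodComm _ _)

protected theorem add_assoc' (x y z : IsoClass F) : x + y + z = x + (y + z) := by
  induction x, y, z using Quotient.inductionOn₃ with
  | h X Y Z => exact sound (X := (X.add Y).add Z) (Y := X.add (Y.add Z)) (prodAssoc _ _ _)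

protected theorem zero_add' (x : IsoClass F) : 0 + x = x := by
  induction x using Quotient.inductionOn with
  | h X => exact sound (X := (QuadSpace.zero F).add X) (zeroProd X.form)

protected theorem mul_comm' (x y : IsoClass F) : x * y = y * x := by
  induction x, y using Quotient.inductionOn₂ with
  | h X Y => exact sound (X := X.mul Y) (Y := Y.mul X) (QuadraticForm.tensorComm _ _)

protected theorem mul_assoc' (x y z : IsoClass F) : x * y * z = x * (y * z) := by
  induction x, y, z using Quotient.inductionOn₃ with
  | h X Y Z =>
    exact sound (X := (X.mul Y).mul Z) (Y := X.mul (Y.mul Z)) (QuadraticForm.tensorAssoc _ _ _)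

protected theorem one_mul' (x : IsoClass F) : 1 * x = x := by
  induction x using Quotient.inductionOn with
  | h X => exact sound (X := (QuadSpace.one F).mul X) (QuadraticForm.tensorLId X.form)

protected theorem zero_mul' (x : IsoClass F) : 0 * x = 0 := by
  induction x using Quotient.inductionOn with
  | h X => exact sound (X := (QuadSpace.zero F).mul X) (Y := QuadSpace.zero F) (zeroTmul X.form)

protected theorem mul_add' (x y z : IsoClass F) : x * (y + z) = x * y + x * z := by
  induction x, y, z using Quotient.inductionOn₃ with
  | h X Y Z =>
    exact sound (X := X.mul (Y.add Z)) (Y := (X.mul Y).add (X.mul Z)) (tmulProd _ _ _)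

end IsoClass

/-- Isometry classes form a commutative semiring under orthogonal sum and tensor product. -/
instance : CommSemiring (IsoClass F) where
  add_assoc := IsoClass.add_assoc'
  add_comm := IsoClass.add_comm'
  zero_add := IsoClass.zero_add'
  add_zero x := (IsoClass.add_comm' x 0).trans (IsoClass.zero_add' x)
  nsmul := nsmulRec
  mul_assoc := IsoClass.mul_assoc'
  mul_comm := IsoClass.mul_comm'
  one_mul := IsoClass.one_mul'
  mul_one x := (IsoClass.mul_comm' x 1).trans (IsoClass.one_mul' x)
  zero_mul := IsoClass.zero_mul'
  mul_zero x := (IsoClass.mul_comm' x 0).trans (IsoClass.zero_mul' x)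
  left_distrib := IsoClass.mul_add'
  right_distrib x y z := by
    rw [IsoClass.mul_comm', IsoClass.mul_add', IsoClass.mul_comm' z, IsoClass.mul_comm' z]

variable (F) in
/-- The isometry class of the hyperbolic plane. -/
def hyperbolicPlane : IsoClass F := .mk (.hyperbolic F F)

theorem mk_add_mk_neg (X : QuadSpace F) :
    IsoClass.mk X + IsoClass.mk X.neg = IsoClass.mk (.hyperbolic F X.V) :=
  IsoClass.sound (X := X.add X.neg) (Y := .hyperbolic F X.V) (prodNeg X.form X.nondegenerate)

theorem mk_neg (X : QuadSpace F) :
    IsoClass.mk X.neg = IsoClass.mk X * IsoClass.mk (QuadSpace.one F).neg :=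
  (IsoClass.sound (X := X.mul (QuadSpace.one F).neg) (Y := X.neg) (tmulNegSq X.form)).symm

theorem mk_hyperbolic_congr {V W : Type u} [AddCommGroup V] [Module F V] [FiniteDimensional F V]
    [AddCommGroup W] [Module F W] [FiniteDimensional F W] (e : V ≃ₗ[F] W) :
    IsoClass.mk (.hyperbolic F V) = IsoClass.mk (.hyperbolic F W) :=
  IsoClass.sound (QuadraticForm.dualProdIsometry e)

theorem mk_hyperbolic_fin (n : ℕ) :
    IsoClass.mk (.hyperbolic F (Fin n → F)) = n • hyperbolicPlane F := by
  induction n with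
  | zero =>
    rw [zero_smul, mk_hyperbolic_congr (LinearEquiv.ofSubsingleton (Fin 0 → F) PUnit.{u + 1})]
    exact IsoClass.sound (Y := QuadSpace.zero F) dualProdPUnit
  | succ n ih =>
    rw [succ_nsmul', ← ih, mk_hyperbolic_congr (Fin.consLinearEquiv F fun _ => F).symm]
    exact IsoClass.sound (X := .hyperbolic F (F × (Fin n → F)))
      (Y := (QuadSpace.hyperbolic F F).add (.hyperbolic F (Fin n → F)))
      QuadraticForm.dualProdProdIsometry

theorem mk_hyperbolic (V : Type u) [AddCommGroup V] [Module F V] [FiniteDimensional F V] :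
    IsoClass.mk (.hyperbolic F V) = Module.finrank F V • hyperbolicPlane F := by
  rw [← mk_hyperbolic_fin, mk_hyperbolic_congr (Module.finBasis F V).equivFun]

theorem one_add_neg_one :
    (1 : IsoClass F) + IsoClass.mk (QuadSpace.one F).neg = hyperbolicPlane F :=
  mk_add_mk_neg (.one F)

theorem exists_mul_hyperbolicPlane (x : IsoClass F) :
    ∃ n : ℕ, x * hyperbolicPlane F = n • hyperbolicPlane F := by
  induction x using Quotient.inductionOn with
  | h X =>
    refine ⟨Module.finrank F X.V, ?_⟩
    change IsoClass.mk X * _ = _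
    rw [← mk_hyperbolic X.V, ← mk_add_mk_neg, mk_neg, ← one_add_neg_one, mul_add, mul_one]

end IsoClass

/-! ### The Witt ring -/

section WittRing

variable (F : Type u) [Field F] [Invertible (2 : F)]

/-- Witt equivalence: `q ~ q'` if `q ⊥ mℍ ≅ q' ⊥ nℍ` for some `m, n`. -/
def wittCon : RingCon (IsoClass F) where
  r x y := ∃ m n : ℕ, x + m • hyperbolicPlane F = y + n • hyperbolicPlane F
  iseqv :=
    { refl := fun x => ⟨0, 0, rfl⟩
      symm := fun ⟨m, n, h⟩ => ⟨n, m, h.symm⟩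
      trans := by
        rintro x y z ⟨m, n, h⟩ ⟨m', n', h'⟩
        refine ⟨m + m', n + n', ?_⟩
        rw [add_smul, ← add_assoc, h, add_right_comm, h', add_right_comm, add_smul, add_assoc] }
  add' := by
    rintro w x y z ⟨m, n, h⟩ ⟨m', n', h'⟩
    refine ⟨m + m', n + n', ?_⟩
    rw [add_smul, add_smul, add_add_add_comm, h, h', add_add_add_comm]
  mul' := by
    rintro w x y z ⟨m, n, h⟩ ⟨m', n', h'⟩
    have key : ∀ x y : IsoClass F, ∀ m n : ℕ, ∃ l : ℕ,
        (x + m • hyperbolicPlane F) * (y + n • hyperbolicPlane F) =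
          x * y + l • hyperbolicPlane F := by
      intro x y m n
      obtain ⟨a, ha⟩ := exists_mul_hyperbolicPlane x
      obtain ⟨b, hb⟩ := exists_mul_hyperbolicPlane y
      obtain ⟨c, hc⟩ := exists_mul_hyperbolicPlane (hyperbolicPlane F)
      refine ⟨n * a + m * b + m * n * c, ?_⟩
      simp only [nsmul_eq_mul] at *
      push_cast
      calc _ = x * y + (n * (x * hyperbolicPlane F) + m * (y * hyperbolicPlane F) +
            m * n * (hyperbolicPlane F * hyperbolicPlane F)) := by ring
        _ = _ := by rw [ha, hb, hc]; ring
    obtain ⟨l, hl⟩ := key w y m m'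
    obtain ⟨l', hl'⟩ := key x z n n'
    exact ⟨l, l', by rw [← hl, ← hl', h, h']⟩

/-- The Witt ring `W(F)`: Witt classes of nonsingular quadratic forms over `F`, with addition the
orthogonal sum and multiplication the tensor product. -/
def WittRing : Type (u + 1) := (wittCon F).Quotient

instance : CommSemiring (WittRing F) := inferInstanceAs (CommSemiring (wittCon F).Quotient)

variable {F}

/-- The Witt class of a nonsingular quadratic form. -/
def WittRing.mk (X : QuadSpace F) : WittRing F := (wittCon F).mk' (IsoClass.mk X)

theorem WittRing.mk_add (X Y : QuadSpace F) : mk (X.add Y) = mk X + mk Y := rfl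

theorem WittRing.mk_mul (X Y : QuadSpace F) : mk (X.mul Y) = mk X * mk Y := rfl

theorem WittRing.mk_zero : mk (.zero F) = 0 := rfl

theorem WittRing.mk_one : mk (.one F) = 1 := rfl

theorem WittRing.exists_mk (x : WittRing F) : ∃ X : QuadSpace F, x = mk X := by
  obtain ⟨y, rfl⟩ := (wittCon F).mk'_surjective x
  obtain ⟨X, rfl⟩ := Quotient.exists_rep y
  exact ⟨X, rfl⟩

theorem WittRing.mk_eq_mk {X Y : QuadSpace F} :
    mk X = mk Y ↔ ∃ m n : ℕ,
      IsoClass.mk X + m • hyperbolicPlane F = IsoClass.mk Y + n • hyperbolicPlane F :=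
  (wittCon F).eq

theorem WittRing.mk_add_mk_neg (X : QuadSpace F) : mk X + mk X.neg = 0 := by
  rw [← mk_add, ← mk_zero, mk_eq_mk]
  refine ⟨0, Module.finrank F X.V, ?_⟩
  rw [zero_smul, add_zero, ← mk_hyperbolic, ← QuadWitt.mk_add_mk_neg, IsoClass.mk_add]
  exact (zero_add _).symm

theorem WittRing.mk_neg (X : QuadSpace F) : mk X.neg = mk (QuadSpace.one F).neg * mk X := by
  rw [mul_comm]
  exact congrArg (wittCon F).mk' (QuadWitt.mk_neg X)

instance : Neg (WittRing F) := ⟨fun x => WittRing.mk (QuadSpace.one F).neg * x⟩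

instance : CommRing (WittRing F) where
  __ := (inferInstance : CommSemiring (WittRing F))
  zsmul := zsmulRec
  neg_add_cancel x := by
    obtain ⟨X, rfl⟩ := x.exists_mk
    change WittRing.mk (QuadSpace.one F).neg * WittRing.mk X + WittRing.mk X = 0
    rw [← WittRing.mk_neg, add_comm, WittRing.mk_add_mk_neg]
  mul_comm := mul_comm

variable (F)

/-- The fundamental ideal `I(F)`: the Witt classes of even-dimensional forms. -/
def fundamentalIdeal : Ideal (WittRing F) where
  carrier := {x | ∃ X : QuadSpace F, Even (Module.finrank F X.V) ∧ x = WittRing.mk X}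
  zero_mem' := ⟨.zero F, by
    change Even (Module.finrank F PUnit.{u + 1})
    rw [Module.finrank_zero_of_subsingleton]
    exact Even.zero, rfl⟩
  add_mem' := by
    rintro _ _ ⟨X, hX, rfl⟩ ⟨Y, hY, rfl⟩
    exact ⟨X.add Y, (Module.finrank_prod (R := F) (M := X.V) (M' := Y.V)) ▸ hX.add hY, rfl⟩
  smul_mem' := by
    rintro c _ ⟨X, hX, rfl⟩
    obtain ⟨C, rfl⟩ := c.exists_mk
    exact ⟨C.mul X, (Module.finrank_tensorProduct (R := F) (S := F) (M := C.V) (M' := X.V)) ▸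
      hX.mul_left _, rfl⟩

/-- The full annihilator ideal `A(F)`: the integer polynomials vanishing at every element of
`W(F)`. -/
def annihilatorIdeal : Ideal (Polynomial ℤ) where
  carrier := {f | ∀ φ : WittRing F, Polynomial.aeval φ f = 0}
  zero_mem' φ := map_zero _
  add_mem' hf hg φ := by rw [map_add, hf φ, hg φ, add_zero]
  smul_mem' c f hf φ := by rw [smul_eq_mul, map_mul, hf φ, mul_zero]

end WittRing

/-- The level of a nonreal field: the least `n` such that `-1` is a sum of `n` squares.
(For formally real fields, whose level is infinite, this has the value `0`.) -/
def level (F : Type u) [Field F] : ℕ :=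
  sInf {n : ℕ | ∃ a : Fin n → F, ∑ i, a i ^ 2 = -1}

/-! ### The ideals of `ℤ[X]` -/

open Polynomial in
/-- The ideal generated by `2^(r - ν₂((2i)!)) p^(2i)` for `0 ≤ i ≤ k - 1`, and `p^(2k)`. -/
def idealJ (p : ℤ[X]) (r k : ℕ) : Ideal ℤ[X] :=
  Ideal.span ({f | ∃ i < k, f = 2 ^ (r - padicValNat 2 (2 * i).factorial) * p ^ (2 * i)} ∪
    {p ^ (2 * k)})

open Polynomial in
/-- `J_{e,r}`, generated by `2^(r - ν₂((2i)!)) X^(2i)` for `0 ≤ i ≤ k - 1`, and `X^(2k)`. -/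
def idealJEven (r k : ℕ) : Ideal ℤ[X] := idealJ X r k

open Polynomial in
/-- `J_{o,r}`, generated by `2^(r - ν₂((2i)!)) (X - 1)^(2i)` for `0 ≤ i ≤ k - 1`, and
`(X - 1)^(2k)`. -/
def idealJOdd (r k : ℕ) : Ideal ℤ[X] := idealJ (X - 1) r k

open Polynomial in
/-- `J_r`, generated by `2^(r - ν₂((2i)!)) X^(2i) (X - 1)^(2i)` for `0 ≤ i ≤ k - 1`, and
`X^(2k) (X - 1)^(2k)`. -/
def idealJFull (r k : ℕ) : Ideal ℤ[X] := idealJ (X * (X - 1)) r k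

end

end QuadWitt

namespace QuadWitt

open Polynomial

/-! ### Polarization of a polynomial that vanishes on an ideal. -/

section Polarization

variable {R : Type*} [CommRing R]

/-! Every Witt class lies in `I = I(F)` or in `1 + I`, so vanishing on `W(F)` means that `f(X)` and
`f(X + 1)` both vanish on `I`. As `X ^ (2k)` and `(X - 1) ^ (2k)` are coprime, the product of the
even and odd ideals is their intersection, and it remains to identify the annihilator of `I` with
`idealJ X r k`.

The generators vanish on `I`: an even-dimensional class is a sum of binary classes `y = ⟨a⟩ + ⟨b⟩`,
each satisfying `y² = 2⟨a⟩y`. Hence `y ^ n` is divisible by the 2-part of `n!`, a property stable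
under sums (`TwoDivided.add`), while Pfister's argument gives `2 ^ r = 0` (`two_pow_eq_zero`).

Conversely, if `f` of degree at most `d` vanishes on `I`, taking differences `d` times shows that
`d!` times its coefficient of degree `d` kills `I ^ d` (`factorial_mul_coeff_mul_eq_zero`). The
nonvanishing hypothesis supplies an element of `I ^ (2k - 1)` of additive order exactly `2 ^ r`, so
for `d < 2k` that coefficient is divisible enough for its monomial to lie in the ideal; descend on
the degree. -/

theorem coeff_taylor_of_natDegree_le {f : R[X]} {j : ℕ} (hf : f.natDegree ≤ j + 1) (e : R) :
    (taylor e f).coeff j = f.coeff j + (j + 1) * f.coeff (j + 1) * e := by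
  have hd : (hasseDeriv j f).natDegree < 2 := by
    have := natDegree_hasseDeriv_le f j
    omega
  rw [taylor_coeff, eval_eq_sum_range' hd, Finset.sum_range_succ, Finset.sum_range_one]
  simp [hasseDeriv_coeff, add_comm 1 j]

/-- The difference `f(X + e) - f(X)` lowers the degree. -/
theorem natDegree_taylor_sub_le {f : R[X]} {j : ℕ} (hf : f.natDegree ≤ j + 1) (e : R) :
    (taylor e f - f).natDegree ≤ j := by
  rw [natDegree_le_iff_coeff_eq_zero]
  intro n hn
  rw [coeff_sub, coeff_taylor_of_natDegree_le (hf.trans (by omega)),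
    coeff_eq_zero_of_natDegree_lt (n := n + 1) (by omega)]
  ring

/-- Polarization: a polynomial of degree at most `j` that vanishes on an ideal `I` has leading
coefficient killed by `j! I ^ j`. -/
theorem factorial_mul_coeff_mul_eq_zero (I : Ideal R) (j : ℕ) :
    ∀ f : R[X], f.natDegree ≤ j → (∀ x ∈ I, f.eval x = 0) →
      ∀ x ∈ I ^ j, (j.factorial : R) * f.coeff j * x = 0 := by
  induction j with
  | zero =>
    intro f _ hf x _
    rw [coeff_zero_eq_eval_zero, hf 0 I.zero_mem, mul_zero, zero_mul]
  | succ j ih =>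
    intro f hd hf x hx
    rw [pow_succ'] at hx
    induction hx using Submodule.mul_induction_on' with
    | mem_mul_mem e he y hy =>
      -- `f(X + e) - f(X)` again vanishes on `I`, and its coefficient of degree `j` is `(j + 1) *
      -- f.coeff (j + 1) * e`: this supplies the next factor of the factorial and the generator `e`
      -- of the extra power of `I`.
      have := ih (taylor e f - f) (natDegree_taylor_sub_le hd e)
        (fun z hz => by
          rw [eval_sub, taylor_eval, hf z hz, hf _ (I.add_mem hz he), sub_zero]) y hy
      rw [coeff_sub, coeff_taylor_of_natDegree_le hd] at this
      rw [Nat.factorial_succ, ← this]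
      push_cast
      ring
    | add y _ z _ hy hz => rw [mul_add, hy, hz, add_zero]

end Polarization

/-! ### 2-adic valuations of factorials. -/

section Valuation

/-- This is why generators with even exponents suffice: passing to the next odd exponent gains no
factor 2. -/
theorem padicValNat_two_factorial_two_mul_add_one (i : ℕ) :
    padicValNat 2 (2 * i + 1).factorial = padicValNat 2 (2 * i).factorial := by
  rw [Nat.factorial_succ, padicValNat.mul (by omega) (Nat.factorial_ne_zero _),
    padicValNat.eq_zero_of_not_dvd (by omega), zero_add]

theorem two_pow_sub_dvd_of_two_pow_dvd_mul {n r : ℕ} (hn : n ≠ 0) {c : ℤ}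
    (h : (2 : ℤ) ^ r ∣ n * c) : (2 : ℤ) ^ (r - padicValNat 2 n) ∣ c := by
  obtain hr | hr := le_total r (padicValNat 2 n)
  · rw [Nat.sub_eq_zero_of_le hr, pow_zero]
    exact one_dvd c
  · obtain ⟨m, hm⟩ := pow_padicValNat_dvd (p := 2) (n := n)
    have hodd : ¬ 2 ∣ m := by
      rintro ⟨l, rfl⟩
      refine pow_succ_padicValNat_not_dvd (p := 2) hn ⟨l, ?_⟩
      rw [pow_succ, mul_assoc, ← hm]
    have hc : IsCoprime ((2 : ℤ) ^ (r - padicValNat 2 n)) m := by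
      refine IsCoprime.pow_left ?_
      exact_mod_cast Nat.isCoprime_iff_coprime.mpr
        ((Nat.Prime.coprime_iff_not_dvd Nat.prime_two).mpr hodd)
    refine hc.dvd_of_dvd_mul_left ?_
    generalize padicValNat 2 n = v at *
    rw [hm, ← Nat.add_sub_cancel' hr, pow_add] at h
    push_cast at h
    rw [mul_assoc] at h
    exact (mul_dvd_mul_iff_left (by positivity)).mp h

end Valuation

/-! ### The ideals `J`, and membership of polynomials vanishing on an ideal. -/

section Ideals

theorem gen_mem_idealJ (p : ℤ[X]) (r : ℕ) {i k : ℕ} (hi : i < k) :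
    2 ^ (r - padicValNat 2 (2 * i).factorial) * p ^ (2 * i) ∈ idealJ p r k :=
  Ideal.subset_span (Or.inl ⟨i, hi, rfl⟩)

theorem pow_mem_idealJ (p : ℤ[X]) (r k : ℕ) : p ^ (2 * k) ∈ idealJ p r k :=
  Ideal.subset_span (Or.inr rfl)

theorem idealJ_le {p : ℤ[X]} {r k : ℕ} {I : Ideal ℤ[X]}
    (h : ∀ i < k, 2 ^ (r - padicValNat 2 (2 * i).factorial) * p ^ (2 * i) ∈ I)
    (h' : p ^ (2 * k) ∈ I) : idealJ p r k ≤ I := by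
  refine Ideal.span_le.mpr ?_
  rintro _ (⟨i, hi, rfl⟩ | rfl)
  exacts [h i hi, h']

theorem isCoprime_idealJ (r k : ℕ) : IsCoprime (idealJEven r k) (idealJOdd r k) := by
  rw [Ideal.isCoprime_iff_exists]
  obtain ⟨a, b, hab⟩ : IsCoprime ((X : ℤ[X]) ^ (2 * k)) ((X - 1) ^ (2 * k)) :=
    IsCoprime.pow ⟨1, -1, by ring⟩
  exact ⟨_, Ideal.mul_mem_left _ a (pow_mem_idealJ X r k), _,
    Ideal.mul_mem_left _ b (pow_mem_idealJ (X - 1) r k), hab⟩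

theorem idealJFull_eq (r k : ℕ) : idealJFull r k = idealJEven r k * idealJOdd r k := by
  apply le_antisymm
  · rw [Ideal.mul_eq_inf_of_isCoprime (isCoprime_idealJ r k)]
    refine idealJ_le (fun i hi => ⟨?_, ?_⟩) ⟨?_, ?_⟩
    · rw [mul_pow, ← mul_assoc]
      exact Ideal.mul_mem_right _ _ (gen_mem_idealJ X r hi)
    · rw [mul_pow, mul_left_comm]
      exact Ideal.mul_mem_left _ _ (gen_mem_idealJ (X - 1) r hi)
    · rw [mul_pow]
      exact Ideal.mul_mem_right _ _ (pow_mem_idealJ X r k)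
    · rw [mul_pow]
      exact Ideal.mul_mem_left _ _ (pow_mem_idealJ (X - 1) r k)
  -- In a product of two generators, the one with the smaller exponent, completed to a power of `X *
  -- (X - 1)`, already lies in the full ideal and divides the product.
  · have key : ∀ {g : ℤ[X]} {i : ℕ}, g * (X * (X - 1)) ^ (2 * i) ∈ idealJFull r k →
        ∀ {h : ℤ[X]} {j : ℕ}, h * (X * (X - 1)) ^ (2 * j) ∈ idealJFull r k →
        g * X ^ (2 * i) * (h * (X - 1) ^ (2 * j)) ∈ idealJFull r k := by
      intro g i hg h j hh
      obtain hij | hij := le_total i j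
      · obtain ⟨d, rfl⟩ := Nat.exists_eq_add_of_le hij
        convert Ideal.mul_mem_right (h * (X - 1) ^ (2 * d)) _ hg using 1
        rw [mul_pow]
        ring
      · obtain ⟨d, rfl⟩ := Nat.exists_eq_add_of_le hij
        convert Ideal.mul_mem_right (g * X ^ (2 * d)) _ hh using 1
        rw [mul_pow]
        ring
    have htop : 1 * (X * (X - 1)) ^ (2 * k) ∈ idealJFull r k := by
      rw [one_mul]
      exact pow_mem_idealJ _ r k
    refine Ideal.span_mul_span' _ _ |>.trans_le (Ideal.span_le.mpr ?_)
    rintro _ ⟨_, ⟨i, hi, rfl⟩ | rfl, _, ⟨j, hj, rfl⟩ | rfl, rfl⟩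
    · exact key (gen_mem_idealJ _ r hi) (gen_mem_idealJ _ r hj)
    · simpa using key (gen_mem_idealJ _ r hi) htop
    · simpa using key htop (gen_mem_idealJ _ r hj)
    · simpa using key htop htop

theorem monomial_mem_idealJ_X {r k d : ℕ} (hd : d < 2 * k) {c : ℤ}
    (h : (2 : ℤ) ^ r ∣ d.factorial * c) : C c * X ^ d ∈ idealJ X r k := by
  have hdvd := two_pow_sub_dvd_of_two_pow_dvd_mul d.factorial_ne_zero h
  obtain ⟨i, b, hi, rfl, hb⟩ : ∃ i b, i < k ∧ d = 2 * i + b ∧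
      padicValNat 2 d.factorial = padicValNat 2 (2 * i).factorial := by
    obtain ⟨i, rfl | rfl⟩ := d.even_or_odd'
    · exact ⟨i, 0, by omega, rfl, rfl⟩
    · exact ⟨i, 1, by omega, rfl, padicValNat_two_factorial_two_mul_add_one i⟩
  rw [hb] at hdvd
  obtain ⟨m, rfl⟩ := hdvd
  convert Ideal.mul_mem_right (C m * X ^ b) _ (gen_mem_idealJ X r hi) using 1
  rw [C_mul, C_pow]
  simp only [pow_add, map_ofNat]
  ring

variable {R : Type*} [CommRing R]

/-- If `2 ^ (r - 1) I ^ (2k - 1) ≠ 0` and the generators of the ideal `J` in `X` vanish on `I`,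
every integer polynomial vanishing on `I` lies in `J`. -/
theorem mem_idealJ_X_of_aeval_eq_zero {I : Ideal R} {r k : ℕ} (hr : 0 < r) (hk : 0 < k)
    (htwo : (2 : R) ^ r = 0) {x : R} (hx : x ∈ I ^ (2 * k - 1)) (hx0 : 2 ^ (r - 1) * x ≠ 0)
    (hJ : ∀ f ∈ idealJ X r k, ∀ φ ∈ I, aeval φ f = 0)
    {f : ℤ[X]} (hf : ∀ φ ∈ I, aeval φ f = 0) : f ∈ idealJ X r k := by
  -- The exact order turns the vanishing of an integer multiple of `x` into divisibility by `2 ^ r`.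
  have hord : addOrderOf x = 2 ^ r := by
    obtain ⟨r, rfl⟩ := Nat.exists_eq_succ_of_ne_zero hr.ne'
    refine addOrderOf_eq_prime_pow ?_ ?_
    · simpa [nsmul_eq_mul] using hx0
    · simp [nsmul_eq_mul, htwo]
  -- Below degree `2k`, strip off the top monomial: it lies in the ideal, hence vanishes on `I`, so
  -- the remainder still vanishes there. Since the top degree is at most `2k - 1`, `x` belongs to
  -- the required power of `I`.
  have low : ∀ d ≤ 2 * k, ∀ f : ℤ[X], f.degree < d → (∀ φ ∈ I, aeval φ f = 0) →
      f ∈ idealJ X r k := by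
    intro d
    induction d with
    | zero =>
      intro _ f hdeg _
      rw [degree_eq_bot.mp (Nat.WithBot.lt_zero_iff.mp hdeg)]
      exact Ideal.zero_mem _
    | succ d ih =>
      intro hd f hdeg hf
      have hnat : f.natDegree ≤ d := natDegree_le_iff_degree_le.mpr (Order.lt_succ_iff.mp hdeg)
      have hzero := factorial_mul_coeff_mul_eq_zero I d (f.map (Int.castRingHom R))
        (natDegree_map_le.trans hnat)
        (fun φ hφ => by rw [eval_map, ← hf φ hφ, aeval_def]; rfl) x
        (Ideal.pow_le_pow_right (by omega) hx)
      have hdvd : (2 : ℤ) ^ r ∣ d.factorial * f.coeff d := by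
        have : ((addOrderOf x : ℕ) : ℤ) ∣ d.factorial * f.coeff d := by
          rw [addOrderOf_dvd_iff_zsmul_eq_zero, zsmul_eq_mul, ← hzero, coeff_map]
          push_cast
          rfl
        rw [hord] at this
        exact_mod_cast this
      have hmem := monomial_mem_idealJ_X (k := k) (by omega) hdvd
      rw [← sub_add_cancel f (C (f.coeff d) * X ^ d)]
      refine Ideal.add_mem _ (ih (by omega) _ ?_ ?_) hmem
      · rw [degree_lt_iff_coeff_zero]
        intro m hm
        rw [coeff_sub, coeff_C_mul_X_pow]
        split_ifs with h
        · rw [h, sub_self]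
        · rw [coeff_eq_zero_of_natDegree_lt (by omega), sub_zero]
      · intro φ hφ
        rw [map_sub, hf φ hφ, hJ _ hmem φ hφ, sub_zero]
  -- Degrees `2k` and above are removed by division by the monic generator `X ^ (2k)`.
  have hmem : X ^ (2 * k) * (f /ₘ X ^ (2 * k)) ∈ idealJ X r k :=
    Ideal.mul_mem_right _ _ (pow_mem_idealJ X r k)
  rw [← modByMonic_add_div f (X ^ (2 * k))]
  refine Ideal.add_mem _ (low (2 * k) le_rfl _ ?_ ?_) hmem
  · simpa using degree_modByMonic_lt f (monic_X_pow (R := ℤ) (2 * k))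
  · intro φ hφ
    rw [← add_sub_cancel_right (f %ₘ X ^ (2 * k)) (X ^ (2 * k) * (f /ₘ X ^ (2 * k))),
      modByMonic_add_div, map_sub, hf φ hφ, hJ _ hmem φ hφ, sub_zero]

theorem mem_idealJ_X_sub_one {r k : ℕ} {f : ℤ[X]} (h : f.comp (X + 1) ∈ idealJ X r k) :
    f ∈ idealJ (X - 1) r k := by
  have hle : idealJ X r k ≤ (idealJ (X - 1) r k).comap (compRingHom (X - 1)) := by
    refine idealJ_le (fun i hi => ?_) ?_
    · simpa [Ideal.mem_comap] using gen_mem_idealJ (X - 1) r hi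
    · simpa [Ideal.mem_comap] using pow_mem_idealJ (X - 1) r k
  simpa [Ideal.mem_comap, comp_assoc] using hle h

end Ideals

/-! ### Powers divisible by the 2-part of the factorial. -/

section DividedPowers

variable {R : Type*} [CommRing R]

/-- Divisibility of `x ^ n` by the `2`-part of `n!`, for all `n`. -/
def TwoDivided (x : R) : Prop :=
  ∀ n : ℕ, (2 : R) ^ padicValNat 2 n.factorial ∣ x ^ n

theorem TwoDivided.zero : TwoDivided (0 : R) := by
  rintro (_ | n) <;> simp

/-- In the binomial expansion, `n! = (n choose m) m! (n - m)!` splits the required power of 2 among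
the three factors of each term. -/
theorem TwoDivided.add {x y : R} (hx : TwoDivided x) (hy : TwoDivided y) :
    TwoDivided (x + y) := by
  intro n
  rw [add_pow]
  refine Finset.dvd_sum fun m hm => ?_
  have hm : m ≤ n := by simpa [Nat.lt_succ_iff] using hm
  have hv : padicValNat 2 n.factorial = padicValNat 2 m.factorial +
      padicValNat 2 (n - m).factorial + padicValNat 2 (n.choose m) := by
    rw [← Nat.choose_mul_factorial_mul_factorial hm,
      padicValNat.mul (mul_ne_zero (Nat.choose_pos hm).ne' m.factorial_ne_zero)
        (n - m).factorial_ne_zero,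
      padicValNat.mul (Nat.choose_pos hm).ne' m.factorial_ne_zero]
    ring
  rw [hv, pow_add, pow_add]
  refine mul_dvd_mul (mul_dvd_mul (hx m) (hy (n - m))) ?_
  exact_mod_cast Nat.cast_dvd_cast (α := R) (pow_padicValNat_dvd (p := 2) (n := n.choose m))

/-- Iterating the relation gives `x ^ (n + 1) = (2c) ^ n x`, and the exponent `n` is enough because
`ν₂((n + 1)!) < n + 1` by Legendre's formula. -/
theorem TwoDivided.of_sq_eq {x c : R} (h : x ^ 2 = 2 * c * x) : TwoDivided x := by
  have key : ∀ n : ℕ, (2 : R) ^ n ∣ x ^ (n + 1) := by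
    intro n
    refine ⟨c ^ n * x, ?_⟩
    induction n with
    | zero => simp
    | succ n ih =>
      rw [pow_succ, ih]
      linear_combination 2 ^ n * c ^ n * h
  rintro (_ | n)
  · simp
  · refine (pow_dvd_pow 2 ?_).trans (key n)
    have := sub_one_mul_padicValNat_factorial_lt_of_ne_zero 2 (n := n + 1) (by omega)
    omega

theorem TwoDivided.mul_pow_eq_zero {x : R} (hx : TwoDivided x) {r n : ℕ}
    (htwo : (2 : R) ^ r = 0) : 2 ^ (r - padicValNat 2 n.factorial) * x ^ n = 0 := by
  obtain ⟨y, hy⟩ := hx n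
  rw [hy, ← mul_assoc, ← pow_add, pow_eq_zero_of_le (by omega) htwo, zero_mul]

theorem TwoDivided.aeval_eq_zero {x : R} {p : ℤ[X]} (hx : TwoDivided (aeval x p)) {r k : ℕ}
    (htwo : (2 : R) ^ r = 0) (hk : r ≤ padicValNat 2 (2 * k).factorial) {f : ℤ[X]}
    (hf : f ∈ idealJ p r k) : aeval x f = 0 := by
  have hle : idealJ p r k ≤ RingHom.ker (aeval x : ℤ[X] →ₐ[ℤ] R) := by
    refine idealJ_le (fun i _ => ?_) ?_
    · rw [RingHom.mem_ker]
      simpa [map_ofNat] using hx.mul_pow_eq_zero (n := 2 * i) htwo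
    · rw [RingHom.mem_ker]
      -- Here the truncated exponent `r - ν₂((2k)!)` is `0`, so the pure power itself vanishes.
      simpa [Nat.sub_eq_zero_of_le hk] using hx.mul_pow_eq_zero (n := 2 * k) htwo
  exact hle hf

end DividedPowers

end QuadWitt

namespace QuadWitt

/-! ### One-dimensional forms, diagonalization and Pfister's level argument. -/

section OneDimensional

variable {F : Type u} [Field F] [Invertible (2 : F)]

theorem nondegenerate_smul_sq (a : Fˣ) :
    QuadraticMap.Nondegenerate (Q := ((a : F) • QuadraticMap.sq : QuadraticForm F F)) := by
  rw [nondegenerate_iff, injective_iff_map_eq_zero]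
  intro x hx
  simpa using congr($hx 1)

/-- The one-dimensional form `⟨a⟩`. -/
def QuadSpace.diag (a : Fˣ) : QuadSpace F :=
  ⟨F, (a : F) • QuadraticMap.sq, nondegenerate_smul_sq a⟩

/-- The Witt class of the one-dimensional form `⟨a⟩`. -/
noncomputable def WittRing.diag (a : Fˣ) : WittRing F := WittRing.mk (QuadSpace.diag a)

theorem WittRing.mk_congr {X Y : QuadSpace F} (e : X.form.IsometryEquiv Y.form) :
    WittRing.mk X = WittRing.mk Y :=
  congrArg (wittCon F).mk' (IsoClass.sound e)

/-- `⟨a⟩ ⊗ ⟨b⟩ ≅ ⟨ab⟩`. -/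
noncomputable def tmulDiag (a b : F) :
    (QuadraticForm.tmul (a • QuadraticMap.sq : QuadraticForm F F)
      (b • QuadraticMap.sq : QuadraticForm F F)).IsometryEquiv
      ((a * b) • QuadraticMap.sq : QuadraticForm F F) where
  toLinearEquiv := TensorProduct.lid F F
  map_app' x := by
    have : (((a * b) • QuadraticMap.sq : QuadraticForm F F).comp
        (TensorProduct.lid F F).toLinearMap) =
        QuadraticForm.tmul (a • QuadraticMap.sq : QuadraticForm F F)
          (b • QuadraticMap.sq : QuadraticForm F F) := by
      refine (QuadraticMap.associated_rightInverse F).injective ?_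
      ext
      simp [QuadraticForm.associated_tmul, QuadraticMap.associated_comp, mul_comm]
    exact congr($this x)

/-- `⟨a + b⟩ ⊥ ⟨ab(a + b)⟩ ≅ ⟨a⟩ ⊥ ⟨b⟩`. -/
noncomputable def prodDiag (a b : F) (h : a + b ≠ 0) :
    (((a + b) • QuadraticMap.sq : QuadraticForm F F).prod
      ((a * b * (a + b)) • QuadraticMap.sq : QuadraticForm F F)).IsometryEquiv
      ((a • QuadraticMap.sq : QuadraticForm F F).prod
        (b • QuadraticMap.sq : QuadraticForm F F)) where
  -- The orthogonal basis `(1, 1)`, `(-b, a)` of `⟨a⟩ ⊥ ⟨b⟩` has values `a + b` and `ab(a + b)`.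
  toFun x := (x.1 - b * x.2, x.1 + a * x.2)
  invFun y := ((a * y.1 + b * y.2) / (a + b), (y.2 - y.1) / (a + b))
  map_add' x y := by ext <;> simp <;> ring
  map_smul' c x := by ext <;> simp <;> ring
  left_inv x := by ext <;> simp <;> field_simp <;> ring
  right_inv x := by ext <;> simp <;> field_simp <;> ring
  map_app' x := by simp; ring

namespace WittRing

theorem diag_mul (a b : Fˣ) : diag (a * b) = diag a * diag b := by
  refine (mk_congr (X := (QuadSpace.diag a).mul (QuadSpace.diag b)) (Y := QuadSpace.diag (a * b))
    ?_).symm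
  exact tmulDiag (a : F) b

theorem diag_one : diag (1 : Fˣ) = 1 := by
  have e : (((1 : Fˣ) : F) • QuadraticMap.sq : QuadraticForm F F).IsometryEquiv
      QuadraticMap.sq := ⟨LinearEquiv.refl F F, fun x => by simp⟩
  exact mk_congr (X := QuadSpace.diag 1) (Y := QuadSpace.one F) e

theorem diag_neg_one : diag (-1 : Fˣ) = -1 := by
  have h : mk (QuadSpace.one F).neg = -1 := eq_neg_of_add_eq_zero_right (mk_add_mk_neg (.one F))
  rw [← h]
  have e : (((-1 : Fˣ) : F) • QuadraticMap.sq : QuadraticForm F F).IsometryEquiv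
      (-QuadraticMap.sq) := ⟨LinearEquiv.refl F F, fun x => by simp⟩
  exact mk_congr (X := QuadSpace.diag (-1)) (Y := (QuadSpace.one F).neg) e

theorem diag_mul_sq (a b : Fˣ) : diag (a * b ^ 2) = diag a := by
  have e : (((a * b ^ 2 : Fˣ) : F) • QuadraticMap.sq : QuadraticForm F F).IsometryEquiv
      ((a : F) • QuadraticMap.sq) :=
    ⟨LinearEquiv.smulOfUnit b, fun x => by
      change (a : F) * ((b * x) * (b * x)) = ((a * b ^ 2 : Fˣ) : F) * (x * x)
      push_cast
      ring⟩
  exact mk_congr (X := QuadSpace.diag (a * b ^ 2)) (Y := QuadSpace.diag a) e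

theorem diag_sq (a : Fˣ) : diag a ^ 2 = 1 := by
  rw [sq, ← diag_mul, ← sq, ← one_mul (a ^ 2), diag_mul_sq, diag_one]

theorem diag_add {a b c : Fˣ} (h : (a : F) + b = c) :
    diag a + diag b = diag c * (1 + diag a * diag b) := by
  have hab : (a : F) + b ≠ 0 := h ▸ c.ne_zero
  have key : mk ((QuadSpace.diag c).add (QuadSpace.diag (a * b * c))) =
      mk ((QuadSpace.diag a).add (QuadSpace.diag b)) := by
    refine mk_congr ?_
    have e := prodDiag (a : F) b hab
    rw [h] at e
    exact e
  calc diag a + diag b = diag c + diag (a * b * c) := key.symm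
    _ = _ := by rw [diag_mul, diag_mul]; ring

/-- Every Witt class is a sum of classes of one-dimensional forms. -/
theorem mk_eq_sum_diag (X : QuadSpace F) :
    ∃ l : List Fˣ, l.length = Module.finrank F X.V ∧ mk X = (l.map diag).sum := by
  -- Diagonal forms are split by peeling off the first coordinate; the remaining form must be shown
  -- nondegenerate again to define a class.
  have key : ∀ (n : ℕ) (w : Fin n → Fˣ)
      (h : (QuadraticMap.weightedSumSquares F w).Nondegenerate),
      mk ⟨Fin n → F, QuadraticMap.weightedSumSquares F w, h⟩ =
        ((List.ofFn w).map diag).sum := by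
    intro n
    induction n with
    | zero =>
      intro w h
      rw [List.ofFn_zero, List.map_nil, List.sum_nil, ← mk_zero]
      have e : (QuadraticMap.weightedSumSquares F w).IsometryEquiv
          (0 : QuadraticForm F PUnit.{u + 1}) :=
        ⟨LinearEquiv.ofSubsingleton _ _, fun x => by
          simp [QuadraticMap.weightedSumSquares_apply]⟩
      exact mk_congr (X := ⟨Fin 0 → F, _, h⟩) (Y := QuadSpace.zero F) e
    | succ n ih =>
      intro w h
      let e : (((w 0 : F) • QuadraticMap.sq : QuadraticForm F F).prod
          (QuadraticMap.weightedSumSquares F (fun i : Fin n => w i.succ))).IsometryEquiv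
          (QuadraticMap.weightedSumSquares F w) :=
        ⟨Fin.consLinearEquiv F fun _ => F, fun x => by
          simp [QuadraticMap.weightedSumSquares_apply, Fin.sum_univ_succ, Units.smul_def]⟩
      have h' : (QuadraticMap.weightedSumSquares F (fun i : Fin n => w i.succ)).Nondegenerate := by
        rw [nondegenerate_iff, injective_iff_map_eq_zero] at h ⊢
        intro x hx
        have := h (Fin.cons 0 x) (LinearMap.ext fun v => by
          have hv := congr($hx (fun i => v i.succ))
          rw [QuadraticMap.associated_apply] at hv ⊢
          simp [QuadraticMap.weightedSumSquares_apply, Fin.sum_univ_succ] at hv ⊢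
          refine hv.imp_right fun hv => ?_
          linear_combination hv)
        funext i
        simpa using congrFun this i.succ
      rw [List.ofFn_succ, List.map_cons, List.sum_cons, ← ih _ h']
      exact (mk_congr (X := (QuadSpace.diag (w 0)).add ⟨Fin n → F, _, h'⟩)
        (Y := ⟨Fin (n + 1) → F, _, h⟩) e).symm
  obtain ⟨w, ⟨e⟩⟩ := X.form.equivalent_weightedSumSquares_units_of_nondegenerate'
    (QuadraticMap.nondegenerate_associated_iff.mpr X.nondegenerate).1
  have hw : (QuadraticMap.weightedSumSquares F w).Nondegenerate := by
    have hX := X.nondegenerate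
    rw [nondegenerate_iff, injective_iff_map_eq_zero] at hX ⊢
    intro x hx
    have := hX (e.symm x) (LinearMap.ext fun v => by
      have hv := congr($hx (e v))
      have hadd : e (e.symm x + v) = x + e v := by
        rw [map_add, e.apply_symm_apply]
      rw [QuadraticMap.associated_apply] at hv ⊢
      rw [← e.map_app, ← e.map_app v, ← e.map_app (e.symm x), hadd, e.apply_symm_apply]
      exact hv)
    rw [← e.apply_symm_apply x, this, map_zero]
  refine ⟨List.ofFn w, List.length_ofFn, ?_⟩
  rw [← key _ w hw]
  exact mk_congr e

/-- If `c` is a nonzero sum of `2 ^ n` squares then `2 ^ n ⟨c⟩ = 2 ^ n ⟨1⟩`. -/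
theorem two_pow_mul_diag (n : ℕ) :
    ∀ (c : Fˣ) (v : Fin (2 ^ n) → F), ∑ i, v i ^ 2 = c → (2 : WittRing F) ^ n * diag c = 2 ^ n := by
  induction n with
  | zero =>
    intro c v hv
    have hv : v 0 ^ 2 = c := by simpa using hv
    have h0 : v 0 ≠ 0 := fun h => c.ne_zero (by rw [← hv, h]; simp)
    have : c = Units.mk0 (v 0) h0 ^ 2 := Units.ext (by simp [hv])
    rw [this, ← one_mul (_ ^ 2), diag_mul_sq, diag_one, mul_one]
  | succ n ih =>
    intro c v hv
    have hpow : 2 ^ (n + 1) = 2 ^ n + 2 ^ n := by ring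
    obtain ⟨x, y, hxy⟩ : ∃ x y : Fin (2 ^ n) → F, ∑ i, x i ^ 2 + ∑ i, y i ^ 2 = c := by
      refine ⟨fun i => v (Fin.cast hpow.symm (Fin.castAdd _ i)),
        fun i => v (Fin.cast hpow.symm (Fin.natAdd _ i)), ?_⟩
      rw [← hv, ← Fin.sum_univ_add (fun i => v (Fin.cast hpow.symm i) ^ 2)]
      exact Equiv.sum_comp (finCongr hpow.symm) (fun i => v i ^ 2)
    -- If one half of the sum vanishes, `c` is already a sum of `2 ^ n` squares and induction
    -- applies directly.
    by_cases hx : ∑ i, x i ^ 2 = 0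
    · rw [hx, zero_add] at hxy
      rw [pow_succ, mul_right_comm, ih c y hxy]
    by_cases hy : ∑ i, y i ^ 2 = 0
    · rw [hy, add_zero] at hxy
      rw [pow_succ, mul_right_comm, ih c x hxy]
    have ha := ih (Units.mk0 _ hx) x rfl
    have hb := ih (Units.mk0 _ hy) y rfl
    -- Multiplied by `2 ^ n`, which absorbs `⟨a⟩` and `⟨b⟩`, the relation `⟨a⟩ + ⟨b⟩ = ⟨c⟩(1 +
    -- ⟨a⟩⟨b⟩)` becomes `2 ^ (n + 1) = 2 ^ (n + 1) ⟨c⟩`.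
    have hab := diag_add (a := Units.mk0 _ hx) (b := Units.mk0 _ hy) (c := c) hxy
    set a := diag (Units.mk0 _ hx)
    set b := diag (Units.mk0 _ hy)
    rw [pow_succ]
    linear_combination (-(2 : WittRing F) ^ n) * hab + ha + hb - diag c * (b * ha + hb)

/-- If `-1` is a sum of `2 ^ n` squares then `2 ^ (n + 1) = 0` in the Witt ring. -/
theorem two_pow_eq_zero {n : ℕ} {v : Fin (2 ^ n) → F} (hv : ∑ i, v i ^ 2 = -1) :
    (2 : WittRing F) ^ (n + 1) = 0 := by
  have := two_pow_mul_diag n (-1) v (by simpa using hv)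
  rw [diag_neg_one] at this
  rw [pow_succ]
  linear_combination -this

/-- Since `⟨a⟩² = ⟨b⟩² = 1`, the square is `2 + 2⟨a⟩⟨b⟩ = 2⟨a⟩(⟨a⟩ + ⟨b⟩)`. -/
theorem twoDivided_diag_add_diag (a b : Fˣ) : TwoDivided (diag a + diag b) :=
  .of_sq_eq (c := diag a) (by linear_combination diag_sq b - diag_sq a)

theorem twoDivided_of_mem_fundamentalIdeal {φ : WittRing F} (h : φ ∈ fundamentalIdeal F) :
    TwoDivided φ := by
  obtain ⟨X, hX, rfl⟩ := h
  obtain ⟨l, hl, hsum⟩ := mk_eq_sum_diag X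
  rw [hsum]
  rw [← hl] at hX
  clear hl hsum
  induction l using List.twoStepInduction with
  | nil => exact .zero
  | singleton a => simp at hX
  | cons_cons a b l ih _ =>
    rw [List.map_cons, List.map_cons, List.sum_cons, List.sum_cons, ← add_assoc]
    refine (twoDivided_diag_add_diag a b).add (ih ?_)
    simpa [Nat.even_add_one] using hX

theorem mem_or_sub_one_mem_fundamentalIdeal (φ : WittRing F) :
    φ ∈ fundamentalIdeal F ∨ φ - 1 ∈ fundamentalIdeal F := by
  obtain ⟨X, rfl⟩ := φ.exists_mk
  obtain h | h := Nat.even_or_odd (Module.finrank F X.V)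
  · exact Or.inl ⟨X, h, rfl⟩
  -- Subtracting `1` amounts to adding `⟨-1⟩`, which makes the dimension even.
  · refine Or.inr ⟨X.add (QuadSpace.diag (-1)), ?_, ?_⟩
    · have : Module.finrank F (X.V × F) = Module.finrank F X.V + 1 := by
        rw [Module.finrank_prod, Module.finrank_self]
      exact this ▸ h.add_one
    · rw [sub_eq_add_neg, ← diag_neg_one]
      rfl

end WittRing

end OneDimensional

end QuadWitt

/-! ### The annihilator ideal. -/

open Polynomial in
theorem mainTheorem2 {F : Type*} [Field F] [Invertible (2 : F)]
    (hF : IsSumSq (-1 : F)) (r k : ℕ)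
    (hs : QuadWitt.level F = 2 ^ (r - 1))
    (hk₁ : padicValNat 2 (2 * k - 2).factorial < r)
    (hk₂ : r ≤ padicValNat 2 (2 * k).factorial)
    (hI : Ideal.span {(QuadWitt.level F : QuadWitt.WittRing F)} *
      QuadWitt.fundamentalIdeal F ^ (2 * k - 1) ≠ ⊥) :
    QuadWitt.annihilatorIdeal F = QuadWitt.idealJFull r k ∧
      QuadWitt.idealJFull r k = QuadWitt.idealJEven r k * QuadWitt.idealJOdd r k := by
  refine ⟨?_, QuadWitt.idealJFull_eq r k⟩
  have hr : 0 < r := by omega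
  have hk : 0 < k := by
    by_contra h
    obtain rfl : k = 0 := by omega
    simp at hk₂
    omega
  have htwo : (2 : QuadWitt.WittRing F) ^ r = 0 := by
    have hmem : QuadWitt.level F ∈ {n : ℕ | ∃ a : Fin n → F, ∑ i, a i ^ 2 = -1} := by
      -- An empty set would give the default level `0`, which is not a power of 2; so the level is
      -- attained.
      refine Nat.sInf_mem (Set.nonempty_iff_ne_empty.mpr fun h => ?_)
      rw [QuadWitt.level, h, Nat.sInf_empty] at hs
      exact (pow_pos two_pos (r - 1)).ne hs
    rw [hs] at hmem
    obtain ⟨v, hv⟩ := hmem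
    have := QuadWitt.WittRing.two_pow_eq_zero hv
    rwa [Nat.sub_add_cancel hr] at this
  obtain ⟨x, hx, hx0⟩ : ∃ x ∈ QuadWitt.fundamentalIdeal F ^ (2 * k - 1),
      (2 : QuadWitt.WittRing F) ^ (r - 1) * x ≠ 0 := by
    by_contra! h
    refine hI (eq_bot_iff.mpr (Ideal.span_singleton_mul_le_iff.mpr fun x hx => ?_))
    rw [hs, Ideal.mem_bot, ← h x hx]
    push_cast
    rfl
  have heven : ∀ f ∈ QuadWitt.idealJ X r k, ∀ φ ∈ QuadWitt.fundamentalIdeal F,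
      aeval φ f = 0 := fun f hf φ hφ =>
    QuadWitt.TwoDivided.aeval_eq_zero
      (by simpa using QuadWitt.WittRing.twoDivided_of_mem_fundamentalIdeal hφ) htwo hk₂ hf
  apply le_antisymm
  · intro f hf
    have he : f ∈ QuadWitt.idealJEven r k :=
      QuadWitt.mem_idealJ_X_of_aeval_eq_zero hr hk htwo hx hx0 heven fun φ _ => hf φ
    have ho : f ∈ QuadWitt.idealJOdd r k := by
      -- `f(X + 1)` also vanishes on `I`, since `f` vanishes on the whole Witt ring; translating
      -- back gives the odd ideal.
      refine QuadWitt.mem_idealJ_X_sub_one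
        (QuadWitt.mem_idealJ_X_of_aeval_eq_zero hr hk htwo hx hx0 heven fun φ _ => ?_)
      rw [aeval_comp]
      exact hf _
    rw [QuadWitt.idealJFull_eq, Ideal.mul_eq_inf_of_isCoprime (QuadWitt.isCoprime_idealJ r k)]
    exact ⟨he, ho⟩
  · intro f hf φ
    rw [QuadWitt.idealJFull_eq,
      Ideal.mul_eq_inf_of_isCoprime (QuadWitt.isCoprime_idealJ r k)] at hf
    obtain ⟨he, ho⟩ := hf
    obtain h | h := QuadWitt.WittRing.mem_or_sub_one_mem_fundamentalIdeal φ
    · exact heven f he φ h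
    · exact QuadWitt.TwoDivided.aeval_eq_zero (p := X - 1)
        (by simpa using QuadWitt.WittRing.twoDivided_of_mem_fundamentalIdeal h) htwo hk₂ ho
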